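/- Let $f:\mathbb R^d\to\mathbb R$ and $P:\mathbb R^d\to\mathbb R^s$ be continuously differentiable, let $D\subseteq\mathbb R^s$ be closed, and consider the problem of minimizing $f(z)$ subject to $P(z)\in D$, with feasible set $\Omega=\{z\in\mathbb R^d : P(z)\in D\}$. For a set $S\subseteq\mathbb R^n$ and $x\in S$, let $$T_S(x)=\{w : \exists\, t_k\downarrow 0,\ w_k\to w \text{ with } x+t_kw_k\in S\ \forall k\}$$ be the tangent (contingent) cone, let $C^*=\{\zeta : \langle\zeta,w\rangle\le 0\ \forall w\in C\}$ be the polar cone of a set $C\subseteq\mathbb R^n$, and let $\widehat N_S(x)=(T_S(x))^*$ be the regular normal cone; for $x\notin S$ put $T_S(x)=\widehat N_S(x)=\emptyset$. Let $\bar z\in\Omega$ be a sharp minimum of the problem, i.e. a local minimizer for which there is $\alpha>0$ with $f(z)\ge f(\bar z)+\alpha\|z-\bar z\|$ for all $z\in\Omega$ close to $\bar z$. Assume that the generalized Guignard constraint qualification (GGCQ) holds at $\bar z$, i.e. $$\widehat N_\Omega(\bar z)=\{u\in\mathbb R^d : \nabla P(\bar z)u\in T_D(P(\bar z))\}^*,$$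 and that the set-valued mapping $M(u)=\nabla P(\bar z)u-T_D(P(\bar z))$ is metrically subregular at $(0,0)$, i.e. there are a neighborhood $W$ of $0$ and $\kappa>0$ such that $\mathrm{dist}(u,M^{-1}(0))\le\kappa\,\mathrm{dist}(0,M(u))$ for all $u\in W$. Then there are $w\in T_D(P(\bar z))$ and a multiplier $w^*\in\widehat N_{T_D(P(\bar z))}(w)$ such that $$\nabla f(\bar z)+\nabla P(\bar z)^*w^*=0.$$ -/

import Mathlib

open Filter Topology
open scoped NNReal

/-- The tangent (Bouligand-Severi, contingent) cone to `Ω` at `z`; it is empty if `z ∉ Ω`. -/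
def contingentCone {n : ℕ} (Ω : Set (EuclideanSpace ℝ (Fin n))) (z : EuclideanSpace ℝ (Fin n)) :
    Set (EuclideanSpace ℝ (Fin n)) :=
  {w | z ∈ Ω ∧ ∃ (t : ℕ → ℝ) (v : ℕ → EuclideanSpace ℝ (Fin n)),
    (∀ k, 0 < t k) ∧ Tendsto t atTop (𝓝 0) ∧ Tendsto v atTop (𝓝 w) ∧
      ∀ k, z + t k • v k ∈ Ω}

/-- The (negative) polar cone `C^*` of a set `C`. -/
def negPolar {n : ℕ} (C : Set (EuclideanSpace ℝ (Fin n))) : Set (EuclideanSpace ℝ (Fin n)) :=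
  {ζ | ∀ w ∈ C, inner ℝ ζ w ≤ 0}

/-- The regular (Fréchet) normal cone to `Ω` at `z`; it is empty if `z ∉ Ω`. -/
def regularNormalCone {n : ℕ} (Ω : Set (EuclideanSpace ℝ (Fin n)))
    (z : EuclideanSpace ℝ (Fin n)) : Set (EuclideanSpace ℝ (Fin n)) :=
  {ζ | z ∈ Ω ∧ ζ ∈ negPolar (contingentCone Ω z)}

/-- Metric subregularity of the set-valued mapping `M` at the point `(z, w)` of its graph.
Distances are extended-real valued, so that the distance to the empty set is `∞`. -/
def IsMetricallySubregularAt {d s : ℕ}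
    (M : EuclideanSpace ℝ (Fin d) → Set (EuclideanSpace ℝ (Fin s)))
    (z : EuclideanSpace ℝ (Fin d)) (w : EuclideanSpace ℝ (Fin s)) : Prop :=
  w ∈ M z ∧ ∃ W ∈ 𝓝 z, ∃ κ : ℝ≥0, 0 < κ ∧
    ∀ x ∈ W, Metric.infEDist x {x' | w ∈ M x'} ≤ κ * Metric.infEDist w (M x)

/-- The feasible region of the program `min f(z)` subject to `P(z) ∈ D`. -/
def feasibleSet {d s : ℕ} (P : EuclideanSpace ℝ (Fin d) → EuclideanSpace ℝ (Fin s))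
    (D : Set (EuclideanSpace ℝ (Fin s))) : Set (EuclideanSpace ℝ (Fin d)) :=
  {z | P z ∈ D}

/-- The linearized tangent cone at `z` to the set of all points whose image under `P` is in `D`. -/
noncomputable def linearizedCone {d s : ℕ}
    (P : EuclideanSpace ℝ (Fin d) → EuclideanSpace ℝ (Fin s))
    (D : Set (EuclideanSpace ℝ (Fin s))) (z : EuclideanSpace ℝ (Fin d)) :
    Set (EuclideanSpace ℝ (Fin d)) :=
  {u | fderiv ℝ P z u ∈ contingentCone D (P z)}

/-- The set-valued mapping `u ↦ ∇P(z) u - T_D(P(z))`. -/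
noncomputable def linearizedMap {d s : ℕ}
    (P : EuclideanSpace ℝ (Fin d) → EuclideanSpace ℝ (Fin s))
    (D : Set (EuclideanSpace ℝ (Fin s))) (z u : EuclideanSpace ℝ (Fin d)) :
    Set (EuclideanSpace ℝ (Fin s)) :=
  {v | ∃ y ∈ contingentCone D (P z), v = fderiv ℝ P z u - y}

/-- The generalized Guignard constraint qualification at `z`. -/
def GGCQ {d s : ℕ} (P : EuclideanSpace ℝ (Fin d) → EuclideanSpace ℝ (Fin s))
    (D : Set (EuclideanSpace ℝ (Fin s))) (z : EuclideanSpace ℝ (Fin d)) : Prop :=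
  P z ∈ D ∧ regularNormalCone (feasibleSet P D) z = negPolar (linearizedCone P D z)

/-- `z` is a sharp (local) minimum of `f` on `Ω`. -/
def IsSharpMinimum {d : ℕ} (f : EuclideanSpace ℝ (Fin d) → ℝ)
    (Ω : Set (EuclideanSpace ℝ (Fin d))) (z : EuclideanSpace ℝ (Fin d)) : Prop :=
  z ∈ Ω ∧ IsLocalMinOn f Ω z ∧
    ∃ α : ℝ, 0 < α ∧ ∀ᶠ x in 𝓝 z, x ∈ Ω → f z + α * ‖x - z‖ ≤ f x

variable {d s n : ℕ}

/-! Write `g` for the gradient, `A` for the derivative of `P`, `T` for the tangent cone to `D`.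
Growth `α * ‖u‖ ≤ ⟨g, u⟩` on a set says that `-g + α • e` is in its polar for every unit `e`, so
GGCQ carries it from the tangent cone of the feasible set to `{u | A u ∈ T}`. Subregularity, global
by homogeneity, bounds the distance to this set by that of `A u` to `T`. Hence `⟨g, u⟩ + dist(A u,
T)² / 2` is coercive and has a minimizer `u`. For `w` nearest to `A u` in `T`, which need not be
convex, `A u - w` is a regular normal at `w`, and stationarity is the multiplier equation. -/

theorem mem_contingentCone_iff {Ω : Set (EuclideanSpace ℝ (Fin n))}
    {z w : EuclideanSpace ℝ (Fin n)} :
    w ∈ contingentCone Ω z ↔ z ∈ Ω ∧ ∀ ε > 0, ∃ t : ℝ, ∃ v : EuclideanSpace ℝ (Fin n),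
      0 < t ∧ t < ε ∧ dist v w < ε ∧ z + t • v ∈ Ω := by
  constructor
  · rintro ⟨hz, t, v, htpos, ht, hv, hmem⟩
    refine ⟨hz, fun ε hε => ?_⟩
    obtain ⟨k, hk1, hk2⟩ :=
      ((ht.eventually_lt_const hε).and (hv.eventually (Metric.ball_mem_nhds w hε))).exists
    exact ⟨t k, v k, htpos k, hk1, hk2, hmem k⟩
  · rintro ⟨hz, h⟩
    have hpos (k : ℕ) : (0 : ℝ) < 1 / ((k : ℝ) + 1) := Nat.one_div_pos_of_nat
    choose t v h1 h2 h3 h4 using fun k : ℕ => h _ (hpos k)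
    refine ⟨hz, t, v, h1, ?_, ?_, h4⟩
    · exact squeeze_zero (fun k => (h1 k).le) (fun k => (h2 k).le)
        tendsto_one_div_add_atTop_nhds_zero_nat
    · exact tendsto_iff_dist_tendsto_zero.2 (squeeze_zero (fun _ => dist_nonneg)
        (fun k => (h3 k).le) tendsto_one_div_add_atTop_nhds_zero_nat)

theorem isClosed_contingentCone (Ω : Set (EuclideanSpace ℝ (Fin n)))
    (z : EuclideanSpace ℝ (Fin n)) : IsClosed (contingentCone Ω z) := by
  refine isClosed_of_closure_subset fun w hw => ?_
  rw [Metric.mem_closure_iff] at hw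
  rw [mem_contingentCone_iff]
  obtain ⟨w₀, hw₀, -⟩ := hw 1 one_pos
  refine ⟨hw₀.1, fun ε hε => ?_⟩
  obtain ⟨w', hw', hd⟩ := hw (ε / 2) (half_pos hε)
  obtain ⟨t, v, h1, h2, h3, h4⟩ := (mem_contingentCone_iff.1 hw').2 (ε / 2) (half_pos hε)
  refine ⟨t, v, h1, by linarith, ?_, h4⟩
  have := dist_triangle v w' w
  rw [dist_comm w' w] at this
  linarith

theorem zero_mem_contingentCone {Ω : Set (EuclideanSpace ℝ (Fin n))}
    {z : EuclideanSpace ℝ (Fin n)} (hz : z ∈ Ω) : 0 ∈ contingentCone Ω z :=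
  mem_contingentCone_iff.2 ⟨hz, fun ε hε => ⟨ε / 2, 0, half_pos hε, half_lt_self hε,
    by simpa using hε, by simpa using hz⟩⟩

theorem smul_mem_contingentCone {Ω : Set (EuclideanSpace ℝ (Fin n))}
    {z w : EuclideanSpace ℝ (Fin n)} (hw : w ∈ contingentCone Ω z) {c : ℝ} (hc : 0 < c) :
    c • w ∈ contingentCone Ω z := by
  obtain ⟨hz, t, v, htpos, ht, hv, hmem⟩ := hw
  refine ⟨hz, fun k => c⁻¹ * t k, fun k => c • v k, fun k => by have := htpos k; positivity,
    by simpa using ht.const_mul c⁻¹, hv.const_smul c, fun k => ?_⟩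
  have : (c⁻¹ * t k) • c • v k = t k • v k := by
    rw [smul_smul]
    congr 1
    field_simp
  rw [this]
  exact hmem k

/-- The displacement from a nearest point is a regular normal. -/
theorem sub_mem_regularNormalCone {T : Set (EuclideanSpace ℝ (Fin n))}
    {a y : EuclideanSpace ℝ (Fin n)} (hy : y ∈ T) (hmin : ∀ x ∈ T, ‖a - y‖ ≤ ‖a - x‖) :
    a - y ∈ regularNormalCone T y := by
  refine ⟨hy, ?_⟩
  rintro w ⟨-, t, v, htpos, ht, hv, hmem⟩
  have hlim : Tendsto (fun k => t k * ‖v k‖ ^ 2) atTop (𝓝 0) := by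
    simpa using ht.mul (hv.norm.pow 2)
  have hlim' : Tendsto (fun k => 2 * inner ℝ (a - y) (v k)) atTop
      (𝓝 (2 * inner ℝ (a - y) w)) := (tendsto_const_nhds.inner hv).const_mul 2
  -- Expanding `‖a - y - t • v‖² ≥ ‖a - y‖²` and dividing by `t` leaves `2⟨a - y, v⟩ ≤ t‖v‖²`.
  have key := le_of_tendsto_of_tendsto' hlim' hlim fun k => by
    have h1 := pow_le_pow_left₀ (norm_nonneg _) (hmin _ (hmem k)) 2
    rw [← sub_sub, norm_sub_sq_real (a - y), inner_smul_right, norm_smul, Real.norm_eq_abs,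
      mul_pow, sq_abs] at h1
    refine le_of_mul_le_mul_left ?_ (htpos k)
    linarith
  linarith

/-- At a sharp minimum the objective grows linearly along tangent directions. -/
theorem IsSharpMinimum.exists_mul_norm_le_inner_gradient
    {f : EuclideanSpace ℝ (Fin d) → ℝ} {Ω : Set (EuclideanSpace ℝ (Fin d))}
    {z : EuclideanSpace ℝ (Fin d)} (h : IsSharpMinimum f Ω z) (hf : DifferentiableAt ℝ f z) :
    ∃ α : ℝ, 0 < α ∧ ∀ u ∈ contingentCone Ω z, α * ‖u‖ ≤ inner ℝ (gradient f z) u := by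
  obtain ⟨-, -, α, hα, hev⟩ := h
  refine ⟨α, hα, ?_⟩
  rintro u ⟨-, t, v, htpos, ht, hv, hmem⟩
  have hgrad : inner ℝ (gradient f z) u = fderiv ℝ f z u := by
    simp [gradient]
  rw [hgrad]
  have htv : Tendsto (fun k => z + t k • v k) atTop (𝓝 z) := by
    simpa using (ht.smul hv).const_add z
  have hlim : Tendsto (fun k => (t k)⁻¹ • (f (z + t k • v k) - f z)) atTop
      (𝓝 (fderiv ℝ f z u)) := by
    refine hf.hasFDerivAt.hasFDerivWithinAt.lim (s := Set.univ)
      (by simpa using ht.smul hv) (Eventually.of_forall fun _ => Set.mem_univ _) ?_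
    refine hv.congr fun k => ?_
    rw [smul_smul, inv_mul_cancel₀ (htpos k).ne', one_smul]
  refine le_of_tendsto_of_tendsto (hv.norm.const_mul α) hlim ?_
  filter_upwards [htv.eventually hev] with k hk
  have h1 := hk (hmem k)
  rw [add_sub_cancel_left, norm_smul, Real.norm_of_nonneg (htpos k).le] at h1
  rw [smul_eq_mul, inv_mul_eq_div, le_div_iff₀ (htpos k)]
  linarith

/-- Linear growth extends from a set to every set with the same polar cone. -/
theorem mul_norm_le_inner_of_negPolar_subset {C L : Set (EuclideanSpace ℝ (Fin d))}
    (hpol : negPolar C ⊆ negPolar L) {g : EuclideanSpace ℝ (Fin d)} {α : ℝ} (hα : 0 < α)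
    (hg : ∀ u ∈ C, α * ‖u‖ ≤ inner ℝ g u) : ∀ u ∈ L, α * ‖u‖ ≤ inner ℝ g u := by
  intro u hu
  rcases eq_or_ne u 0 with rfl | hu0
  · simp
  have hn : 0 < ‖u‖ := norm_pos_iff.2 hu0
  -- Cauchy–Schwarz gives membership; pairing this vector with `u` itself then gives the growth at
  -- `u`.
  have hmem : -g + (α / ‖u‖) • u ∈ negPolar C := fun x hx => by
    have h1 := hg x hx
    have h2 := mul_le_mul_of_nonneg_left (real_inner_le_norm u x) (div_pos hα hn).le
    have h3 : α / ‖u‖ * (‖u‖ * ‖x‖) = α * ‖x‖ := by field_simp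
    rw [inner_add_left, inner_neg_left, real_inner_smul_left]
    linarith
  have h1 := hpol hmem u hu
  have h3 : α / ‖u‖ * (‖u‖ * ‖u‖) = α * ‖u‖ := by field_simp
  rw [inner_add_left, inner_neg_left, real_inner_smul_left, real_inner_self_eq_norm_mul_norm] at h1
  linarith

theorem setOf_zero_mem_linearizedMap (P : EuclideanSpace ℝ (Fin d) → EuclideanSpace ℝ (Fin s))
    (D : Set (EuclideanSpace ℝ (Fin s))) (z : EuclideanSpace ℝ (Fin d)) :
    {u | 0 ∈ linearizedMap P D z u} = linearizedCone P D z := by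
  ext u
  constructor
  · rintro ⟨y, hy, h⟩
    rw [eq_comm, sub_eq_zero] at h
    exact (congrArg (· ∈ contingentCone D (P z)) h).mpr hy
  · exact fun h => ⟨_, h, (sub_self _).symm⟩

theorem isClosed_linearizedCone (P : EuclideanSpace ℝ (Fin d) → EuclideanSpace ℝ (Fin s))
    (D : Set (EuclideanSpace ℝ (Fin s))) (z : EuclideanSpace ℝ (Fin d)) :
    IsClosed (linearizedCone P D z) :=
  (isClosed_contingentCone D (P z)).preimage (fderiv ℝ P z).continuous

/-- By homogeneity, subregularity of the linearized map at the origin is a global error bound. -/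
theorem IsMetricallySubregularAt.exists_global_error_bound
    {P : EuclideanSpace ℝ (Fin d) → EuclideanSpace ℝ (Fin s)}
    {D : Set (EuclideanSpace ℝ (Fin s))} {z : EuclideanSpace ℝ (Fin d)}
    (hz : P z ∈ D) (h : IsMetricallySubregularAt (linearizedMap P D z) 0 0) :
    ∃ κ : ℝ, 0 < κ ∧ ∀ u, ∀ y ∈ contingentCone D (P z), ∃ p ∈ linearizedCone P D z,
      ‖u - p‖ ≤ κ * ‖fderiv ℝ P z u - y‖ := by
  obtain ⟨-, W, hW, κ, hκ, hbound⟩ := h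
  refine ⟨κ, hκ, fun u y hy => ?_⟩
  have hlim : Tendsto (fun t : ℝ => t • u) (𝓝[>] 0) (𝓝 0) := by
    have : Tendsto (fun t : ℝ => t • u) (𝓝 0) (𝓝 ((0 : ℝ) • u)) :=
      tendsto_id.smul tendsto_const_nhds
    rw [zero_smul] at this
    exact this.mono_left nhdsWithin_le_nhds
  obtain ⟨t, htW, ht⟩ := ((hlim.eventually hW).and self_mem_nhdsWithin).exists
  have ht : 0 < t := ht
  have h0 : (0 : EuclideanSpace ℝ (Fin d)) ∈ linearizedCone P D z := by
    simpa [linearizedCone] using zero_mem_contingentCone hz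
  obtain ⟨q, hq, hqd⟩ :=
    (isClosed_linearizedCone P D z).exists_infDist_eq_dist ⟨0, h0⟩ (t • u)
  have hb := hbound _ htW
  rw [setOf_zero_mem_linearizedMap] at hb
  have hM : fderiv ℝ P z (t • u) - t • y ∈ linearizedMap P D z (t • u) :=
    ⟨_, smul_mem_contingentCone hy ht, rfl⟩
  have hb' := hb.trans (mul_le_mul_right (Metric.infEDist_le_edist_of_mem hM) (κ : ENNReal))
  have hfin : (κ : ENNReal) * edist 0 (fderiv ℝ P z (t • u) - t • y) ≠ ⊤ :=
    ENNReal.mul_ne_top ENNReal.coe_ne_top (edist_ne_top _ _)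
  have hr := ENNReal.toReal_mono hfin hb'
  rw [ENNReal.toReal_mul, ENNReal.coe_toReal, ← dist_edist, dist_zero_left, map_smul, ← smul_sub,
    norm_smul, Real.norm_of_nonneg ht.le] at hr
  change Metric.infDist (t • u) (linearizedCone P D z) ≤ _ at hr
  rw [hqd, dist_eq_norm] at hr
  refine ⟨t⁻¹ • q, ?_, ?_⟩
  · change fderiv ℝ P z (t⁻¹ • q) ∈ contingentCone D (P z)
    rw [map_smul]
    exact smul_mem_contingentCone hq (inv_pos.2 ht)
  · have : t • u - q = t • (u - t⁻¹ • q) := by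
      rw [smul_sub, smul_smul, mul_inv_cancel₀ ht.ne', one_smul]
    rw [this, norm_smul, Real.norm_of_nonneg ht.le] at hr
    refine le_of_mul_le_mul_left ?_ ht
    linarith

/-- A nonnegative perturbation of a linear form by a quadratic one forces the form to vanish. -/
theorem eq_zero_of_forall_inner_add_sq_nonneg {E F : Type*} [NormedAddCommGroup E]
    [InnerProductSpace ℝ E] [NormedAddCommGroup F] [NormedSpace ℝ F] (A : E →L[ℝ] F) {G : E}
    (h : ∀ x, 0 ≤ inner ℝ G x + ‖A x‖ ^ 2 / 2) : G = 0 := by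
  -- Along `t • G` the form is a quadratic in `t` without constant term, so its discriminant is the
  -- square of the linear coefficient `‖G‖²`.
  have hd : discrim (‖A G‖ ^ 2 / 2) (‖G‖ ^ 2) 0 ≤ 0 := discrim_le_zero fun t => by
    have := h (t • G)
    rw [inner_smul_right, real_inner_self_eq_norm_sq, map_smul, norm_smul, Real.norm_eq_abs,
      mul_pow, sq_abs] at this
    linarith
  rw [discrim, mul_zero, sub_zero] at hd
  have : (‖G‖ ^ 2) ^ 2 = 0 := le_antisymm hd (by positivity)
  simpa using this

/-- The quadratic penalization of a linear form that grows linearly on the preimage of a closed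
set admitting a global error bound attains its minimum, which yields a multiplier. -/
theorem exists_regularNormalCone_multiplier
    (A : EuclideanSpace ℝ (Fin d) →L[ℝ] EuclideanSpace ℝ (Fin s))
    {T : Set (EuclideanSpace ℝ (Fin s))} (hT : IsClosed T) (hne : T.Nonempty)
    {g : EuclideanSpace ℝ (Fin d)} {α κ : ℝ} (hα : 0 < α)
    (hg : ∀ u, A u ∈ T → α * ‖u‖ ≤ inner ℝ g u)
    (herr : ∀ u, ∀ y ∈ T, ∃ p, A p ∈ T ∧ ‖u - p‖ ≤ κ * ‖A u - y‖) :
    ∃ w ∈ T, ∃ wstar ∈ regularNormalCone T w, g + ContinuousLinearMap.adjoint A wstar = 0 := by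
  set ψ : EuclideanSpace ℝ (Fin d) → ℝ := fun u =>
    inner ℝ g u + Metric.infDist (A u) T ^ 2 / 2 with hψ
  have hcont : Continuous ψ := by
    have : Continuous fun u => Metric.infDist (A u) T :=
      (Metric.continuous_infDist_pt T).comp A.continuous
    exact (continuous_const.inner continuous_id).add ((this.pow 2).div_const 2)
  -- With `c = (α + ‖g‖) * κ` and `δ` the distance, replacing `u` by `p` costs at most `c * δ`, and
  -- `c * δ ≤ c² / 2 + δ² / 2`; the penalty absorbs the last term.
  have hlower (u) : α * ‖u‖ - ((α + ‖g‖) * κ) ^ 2 / 2 ≤ ψ u := by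
    obtain ⟨y, hy, hyd⟩ := hT.exists_infDist_eq_dist hne (A u)
    obtain ⟨p, hp, hup⟩ := herr u y hy
    rw [← dist_eq_norm (A u), ← hyd] at hup
    have h1 := hg p hp
    have h2 : inner ℝ g p - ‖g‖ * ‖u - p‖ ≤ inner ℝ g u := by
      have := (abs_le.1 (abs_real_inner_le_norm g (u - p))).1
      rw [inner_sub_right] at this
      linarith
    have h3 : α * ‖u‖ ≤ α * ‖p‖ + α * ‖u - p‖ := by
      rw [← mul_add]
      refine mul_le_mul_of_nonneg_left ?_ hα.le
      have := norm_add_le p (u - p)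
      rwa [add_sub_cancel] at this
    have h4 := mul_le_mul_of_nonneg_left hup (add_nonneg hα.le (norm_nonneg g))
    have h5 := sq_nonneg ((α + ‖g‖) * κ - Metric.infDist (A u) T)
    simp only [hψ]
    linarith
  have hcoer : Tendsto ψ (cocompact _) atTop := by
    refine tendsto_atTop_mono hlower ?_
    exact tendsto_atTop_add_const_right _ _
      ((tendsto_norm_cocompact_atTop).const_mul_atTop hα)
  obtain ⟨u, hu⟩ := hcont.exists_forall_le hcoer
  obtain ⟨y, hy, hyd⟩ := hT.exists_infDist_eq_dist hne (A u)
  refine ⟨y, hy, A u - y, sub_mem_regularNormalCone hy fun x hx => ?_, ?_⟩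
  · rw [← dist_eq_norm, ← dist_eq_norm, ← hyd]
    exact Metric.infDist_le_dist_of_mem hx
  · refine eq_zero_of_forall_inner_add_sq_nonneg A fun x => ?_
    have h1 := hu (u + x)
    -- Freezing the nearest point `y` majorizes the penalty by a smooth quadratic, with equality at
    -- `x = 0`, so the distance need not be differentiated.
    have h2 : Metric.infDist (A (u + x)) T ^ 2 ≤ ‖(A u - y) + A x‖ ^ 2 := by
      refine pow_le_pow_left₀ Metric.infDist_nonneg ?_ 2
      have := Metric.infDist_le_dist_of_mem (x := A (u + x)) hy
      rwa [dist_eq_norm, map_add A u x, add_sub_right_comm, ← map_add] at this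
    simp only [hψ, hyd, dist_eq_norm, inner_add_right] at h1
    rw [norm_add_sq_real] at h2
    rw [inner_add_left, ContinuousLinearMap.adjoint_inner_left]
    linarith

theorem mainTheorem3 {d s : ℕ}
    (f : EuclideanSpace ℝ (Fin d) → ℝ)
    (P : EuclideanSpace ℝ (Fin d) → EuclideanSpace ℝ (Fin s))
    (D : Set (EuclideanSpace ℝ (Fin s)))
    (hf : ContDiff ℝ 1 f) (hP : ContDiff ℝ 1 P) (hD : IsClosed D)
    (zb : EuclideanSpace ℝ (Fin d))
    (hsharp : IsSharpMinimum f (feasibleSet P D) zb)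
    (hGGCQ : GGCQ P D zb)
    (hsub : IsMetricallySubregularAt (linearizedMap P D zb) 0 0) :
    ∃ w ∈ contingentCone D (P zb),
      ∃ wstar ∈ regularNormalCone (contingentCone D (P zb)) w,
        gradient f zb + ContinuousLinearMap.adjoint (fderiv ℝ P zb) wstar = 0 := by
  obtain ⟨α, hα, hgrow⟩ :=
    hsharp.exists_mul_norm_le_inner_gradient (hf.differentiable one_ne_zero zb)
  obtain ⟨κ, -, herr⟩ := hsub.exists_global_error_bound hGGCQ.1
  have hpol : negPolar (contingentCone (feasibleSet P D) zb) ⊆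
      negPolar (linearizedCone P D zb) := fun ζ hζ => by
    rw [← hGGCQ.2]
    exact ⟨hGGCQ.1, hζ⟩
  exact exists_regularNormalCone_multiplier (fderiv ℝ P zb) (isClosed_contingentCone D (P zb))
    ⟨0, zero_mem_contingentCone hGGCQ.1⟩ hα
    (mul_norm_le_inner_of_negPolar_subset hpol hα hgrow) herr
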